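/- All Hilbert spaces are complex. For a contraction $T$ on a Hilbert space $\mathcal H$ put $D_{T^*}=(I-TT^*)^{1/2}$ and $\mathcal D_{T^*}=\overline{D_{T^*}\mathcal H}$. A contraction $T$ is called pure if $\|T^{*m}h\|\to 0$ as $m\to\infty$ for every $h\in\mathcal H$; a pure isometry is an isometry that is a pure contraction. For a Hilbert space $\mathcal E$, let $H^2(\mathcal E)$ be the Hilbert space of functions $f(z)=\sum_{k\ge 0}\eta_k z^k$ on the open unit disc $\mathbb D$ with $\eta_k\in\mathcal E$ and $\|f\|^2=\sum_k\|\eta_k\|^2<\infty$, and for an operator-valued function $\Phi:\mathbb D\to\mathcal B(\mathcal E)$ let $M_\Phi$ denote the multiplication operator $(M_\Phi f)(z)=\Phi(z)f(z)$. Theorem 5.2. Let $(T_1,T_2)$ be a pair of commuting pure contractions on a Hilbert space $\mathcal H$ with $\dim\mathcal D_{T_i^*}<\infty$ for $i=1,2$. Put $\mathcal E=\mathcal D_{T_1^*}\oplus\mathcal D_{T_2^*}$ and let $P$ be the orthogonal projection of $\mathcal E$ onto the second summand, $P^\perp=I-P$. Then there is a unitary $U$ on $\mathcal E$ with $$U\,(D_{T_1^*}T_2^*h,\;D_{T_2^*}h)=(D_{T_1^*}h,\;D_{T_2^*}T_1^*h)\qquad(h\in\mathcal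 H)$$ such that, with $$\Phi(z)=(P+zP^\perp)U^*,\qquad \Psi(z)=U(P^\perp+zP)\qquad(z\in\mathbb D),$$ the multiplication operators $M_\Phi,M_\Psi$ are bounded on $H^2(\mathcal E)$, they are commuting pure isometries, and $(T_1,T_2)$ dilates to $(M_\Phi,M_\Psi)$: there is a linear isometry $\Pi:\mathcal H\to H^2(\mathcal E)$ with $\Pi T_1^*=M_\Phi^*\Pi$ and $\Pi T_2^*=M_\Psi^*\Pi$. -/

import Mathlib

open Filter Topology ContinuousLinearMap
open scoped ComplexConjugate InnerProductSpace

noncomputable section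

namespace PureDilation

/-! ### The vector-valued Hardy space on the unit disc -/

section Hardy

variable {E : Type*} [NormedAddCommGroup E] [InnerProductSpace ℂ E] [CompleteSpace E]

/-- A power series with square-summable coefficients converges at every point of the disc. -/
theorem summable_pow_smul (η : lp (fun _ : ℕ => E) 2) (z : Complex.UnitDisc) :
    Summable (fun k : ℕ => (z : ℂ) ^ k • η k) := by
  have hz : ‖(z : ℂ)‖ < 1 := z.norm_lt_one
  have hb : ∀ k : ℕ, ‖(z : ℂ) ^ k • η k‖ ≤ ‖(z : ℂ)‖ ^ k * ‖η‖ := fun k => by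
    rw [norm_smul, norm_pow]
    exact mul_le_mul_of_nonneg_left (lp.norm_apply_le_norm (by norm_num) η k) (by positivity)
  exact Summable.of_norm_bounded
    ((summable_geometric_of_lt_one (norm_nonneg _) hz).mul_right ‖η‖) hb

variable (E) in
/-- The map sending a square-summable sequence `(η_k)` in `E` to the function
`z ↦ ∑ η_k z ^ k` on the open unit disc. -/
def powerSeriesMap : lp (fun _ : ℕ => E) 2 →ₗ[ℂ] (Complex.UnitDisc → E) where
  toFun η := fun z => ∑' k : ℕ, (z : ℂ) ^ k • η k
  map_add' η ξ := by
    funext z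
    simp only [lp.coeFn_add, Pi.add_apply, smul_add]
    exact (summable_pow_smul η z).tsum_add (summable_pow_smul ξ z)
  map_smul' c η := by
    funext z
    simp only [lp.coeFn_smul, Pi.smul_apply, RingHom.id_apply]
    rw [← (summable_pow_smul η z).tsum_const_smul c]
    exact tsum_congr fun k => smul_comm _ _ _

/-- The Taylor coefficients are determined by the function. -/
theorem powerSeriesMap_injective : Function.Injective (powerSeriesMap E) := by
  rw [injective_iff_map_eq_zero]
  intro η hη
  let p : FormalMultilinearSeries ℂ ℂ E :=
    fun k => ContinuousMultilinearMap.mkPiRing ℂ (Fin k) (η k)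
  have hsum : ∀ y : ℂ, ‖y‖ < 1 → HasSum (fun k : ℕ => p k fun _ => y) 0 := by
    intro y hy
    have h1 := (summable_pow_smul η (Complex.UnitDisc.mk y hy)).hasSum
    have h2 : ∑' k : ℕ, ((Complex.UnitDisc.mk y hy : Complex.UnitDisc) : ℂ) ^ k • η k = 0 :=
      congrFun hη (Complex.UnitDisc.mk y hy)
    rw [h2] at h1
    simpa [p] using h1
  have hp : HasFPowerSeriesOnBall (fun _ : ℂ => (0 : E)) p 0 1 := by
    refine ⟨?_, one_pos, ?_⟩
    · refine FormalMultilinearSeries.le_radius_of_bound p (r := 1) ‖η‖ fun k => ?_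
      simpa [p] using lp.norm_apply_le_norm (by norm_num) η k
    · intro y hy
      have hy' : ‖y‖ < 1 := by
        have h1 : edist y 0 < 1 := hy
        rw [edist_dist, ENNReal.ofReal_lt_one, dist_zero_right] at h1
        exact h1
      simpa using hsum y hy'
  have h0 : p = 0 := hp.hasFPowerSeriesAt.eq_zero
  ext k
  have hk : p k (fun _ => 1) = 0 := by rw [h0]; rfl
  simpa [p] using hk

variable (E) in
/-- The Hardy space `H²(E)`: the `E`-valued functions on the open unit disc of the form
`f(z) = ∑ η_k z ^ k` with `∑ ‖η_k‖ ^ 2 < ∞`. -/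
def HardySpace : Type _ := LinearMap.range (powerSeriesMap E)

namespace HardySpace

instance : CoeFun (HardySpace E) (fun _ => Complex.UnitDisc → E) := ⟨fun f => f.1⟩

instance : AddCommGroup (HardySpace E) :=
  inferInstanceAs (AddCommGroup (LinearMap.range (powerSeriesMap E)))

instance : Module ℂ (HardySpace E) :=
  inferInstanceAs (Module ℂ (LinearMap.range (powerSeriesMap E)))

variable (E) in
/-- The sequence of Taylor coefficients of a function in `H²(E)`. -/
def coeffEquiv : HardySpace E ≃ₗ[ℂ] lp (fun _ : ℕ => E) 2 :=
  (LinearEquiv.ofInjective (powerSeriesMap E) powerSeriesMap_injective).symm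

theorem hasSum_coeff (f : HardySpace E) (z : Complex.UnitDisc) :
    HasSum (fun k : ℕ => (z : ℂ) ^ k • coeffEquiv E f k) (f z) := by
  have h := (summable_pow_smul (coeffEquiv E f) z).hasSum
  have h2 : powerSeriesMap E (coeffEquiv E f) = f.1 :=
    congrArg Subtype.val
      ((LinearEquiv.ofInjective (powerSeriesMap E) powerSeriesMap_injective).apply_symm_apply f)
  rw [← h2]
  exact h

/-- The norm of `H²(E)` is the `ℓ²` norm of the Taylor coefficients. -/
instance : NormedAddCommGroup (HardySpace E) :=
  NormedAddCommGroup.induced (HardySpace E) (lp (fun _ : ℕ => E) 2) (coeffEquiv E)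
    (coeffEquiv E).injective

theorem norm_coeff (f : HardySpace E) : ‖coeffEquiv E f‖ = ‖f‖ := rfl

/-- The inner product of `H²(E)` is `⟪f, g⟫ = ∑ ⟪f_k, g_k⟫` in terms of Taylor coefficients. -/
instance : InnerProductSpace ℂ (HardySpace E) where
  norm_smul_le c f := by
    rw [← norm_coeff, ← norm_coeff, map_smul]
    exact norm_smul_le c _
  inner f g := ⟪coeffEquiv E f, coeffEquiv E g⟫_ℂ
  norm_sq_eq_re_inner f := by
    rw [← norm_coeff]
    exact InnerProductSpace.norm_sq_eq_re_inner _
  conj_inner_symm f g := InnerProductSpace.conj_inner_symm _ _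
  add_left f g h := by
    rw [map_add]
    exact InnerProductSpace.add_left _ _ _
  smul_left f g c := by
    rw [map_smul]
    exact InnerProductSpace.smul_left _ _ _

variable (E) in
/-- Taking Taylor coefficients, as an isometric isomorphism. -/
def coeffIsometry : HardySpace E ≃ₗᵢ[ℂ] lp (fun _ : ℕ => E) 2 :=
  ⟨coeffEquiv E, norm_coeff⟩

instance : CompleteSpace (HardySpace E) :=
  (coeffIsometry E).toIsometryEquiv.completeSpace

end HardySpace

/-- `M` is the multiplication operator `M_Φ` on `H²(E)` with operator-valued symbol `Φ`:
`(M f)(z) = Φ(z) f(z)`. -/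
def IsMulOperator (Φ : Complex.UnitDisc → (E →L[ℂ] E))
    (M : HardySpace E →L[ℂ] HardySpace E) : Prop :=
  ∀ (f : HardySpace E) (z : Complex.UnitDisc), (M f) z = Φ z (f z)

variable (E) in
/-- A BCL triple on `E`: a unitary operator `U` and an orthogonal projection `P`. -/
structure BCLTriple where
  U : E →L[ℂ] E
  P : E →L[ℂ] E
  unitary_U : U ∈ unitary (E →L[ℂ] E)
  projection_P : IsStarProjection P

/-- The symbol `Φ(z) = (P + z P^⊥) U^*`. -/
def BCLTriple.symbolPhi (B : BCLTriple E) (z : Complex.UnitDisc) : E →L[ℂ] E :=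
  (B.P + (z : ℂ) • (1 - B.P)) ∘L adjoint B.U

/-- The symbol `Ψ(z) = U (P^⊥ + z P)`. -/
def BCLTriple.symbolPsi (B : BCLTriple E) (z : Complex.UnitDisc) : E →L[ℂ] E :=
  B.U ∘L ((1 - B.P) + (z : ℂ) • B.P)

end Hardy

/-! ### Contractions, defect spaces and dilations -/

section Operators

variable {H : Type*} [NormedAddCommGroup H] [InnerProductSpace ℂ H] [CompleteSpace H]
variable {K : Type*} [NormedAddCommGroup K] [InnerProductSpace ℂ K] [CompleteSpace K]

/-- A pure contraction: `‖T‖ ≤ 1` and `T^{*m} → 0` strongly. -/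
def IsPureContraction (T : H →L[ℂ] H) : Prop :=
  ‖T‖ ≤ 1 ∧ ∀ h : H, Tendsto (fun m : ℕ => ‖((adjoint T) ^ m) h‖) atTop (𝓝 0)

/-- A pure isometry: an isometry that is a pure contraction. -/
def IsPureIsometry (V : H →L[ℂ] H) : Prop :=
  Isometry V ∧ IsPureContraction V

/-- The defect operator `D_T = (I - T^* T)^{1/2}` of a contraction `T`. -/
def defectOp (T : H →L[ℂ] H) : H →L[ℂ] H :=
  CFC.sqrt (1 - adjoint T ∘L T)

theorem defectOp_mul_self (T : H →L[ℂ] H) (hT : ‖T‖ ≤ 1) :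
    defectOp T * defectOp T = 1 - adjoint T ∘L T := by
  refine CFC.sqrt_mul_sqrt_self _ ?_
  rw [sub_nonneg]
  have h := CStarAlgebra.star_mul_le_algebraMap_norm_sq (a := T)
  refine h.trans ?_
  rw [Algebra.algebraMap_eq_smul_one]
  have h1 : ‖T‖ ^ 2 ≤ 1 := pow_le_one₀ (norm_nonneg _) hT
  calc ‖T‖ ^ 2 • (1 : H →L[ℂ] H) ≤ (1 : ℝ) • (1 : H →L[ℂ] H) :=
        smul_le_smul_of_nonneg_right h1 zero_le_one
    _ = 1 := one_smul _ _

theorem defectOp_nonneg (T : H →L[ℂ] H) : 0 ≤ defectOp T :=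
  CFC.sqrt_nonneg _

/-- The defect space: the closure of the range of `D_T`. -/
abbrev defectSpace (T : H →L[ℂ] H) : Submodule ℂ H :=
  (defectOp T).range.topologicalClosure

/-- The defect operator with values in the defect space. -/
def defectVec (T : H →L[ℂ] H) (h : H) : defectSpace T :=
  ⟨defectOp T h, Submodule.le_topologicalClosure _ (LinearMap.mem_range_self _ h)⟩

/-- The Hilbert space direct sum `D_{T₁^*} ⊕ D_{T₂^*}`. -/
abbrev DefectSum (T₁ T₂ : H →L[ℂ] H) : Type _ :=
  WithLp 2 (defectSpace (adjoint T₁) × defectSpace (adjoint T₂))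

/-- The BCL triple `(D_{T₁^*} ⊕ D_{T₂^*}, U, P)` belongs to the pair `(T₁, T₂)`: `P` is the
projection onto the second summand, and
`U (D_{T₁^*} T₂^* h, D_{T₂^*} h) = (D_{T₁^*} h, D_{T₂^*} T₁^* h)` for all `h`. -/
def BCLTriple.IsCompleteFor {T₁ T₂ : H →L[ℂ] H} (B : BCLTriple (DefectSum T₁ T₂)) : Prop :=
  (∀ (x : defectSpace (adjoint T₁)) (y : defectSpace (adjoint T₂)),
      B.P (WithLp.toLp 2 (x, y)) = WithLp.toLp 2 (0, y)) ∧
  ∀ h : H,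
    B.U (WithLp.toLp 2 (defectVec (adjoint T₁) (adjoint T₂ h), defectVec (adjoint T₂) h)) =
      WithLp.toLp 2 (defectVec (adjoint T₁) h, defectVec (adjoint T₂) (adjoint T₁ h))

/-- The pair `(V₁, V₂)` on `K` is a dilation of the pair `(T₁, T₂)` on `H`: there is an isometry
`J : H → K` with `J T_i^* = V_i^* J` for `i = 1, 2`. -/
def IsPairDilation (T₁ T₂ : H →L[ℂ] H) (V₁ V₂ : K →L[ℂ] K) : Prop :=
  ∃ J : H →ₗᵢ[ℂ] K, ∀ h : H,
    J (adjoint T₁ h) = adjoint V₁ (J h) ∧ J (adjoint T₂ h) = adjoint V₂ (J h)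

end Operators

end PureDilation

end

noncomputable section

namespace PureDilation

/-! ### Powers of contractions on finite-dimensional spaces -/

section Powers

variable {E : Type*} [NormedAddCommGroup E] [InnerProductSpace ℂ E]

/-! Put `C = T₁^* T₂^*`, `V h = (D_{T₁^*} T₂^* h, D_{T₂^*} h)` and `W h = (D_{T₁^*} h, D_{T₂^*} T₁^*
h)`. Since `D_{T^*}² = I - T T^*`, both `‖V h‖²` and `‖W h‖²` telescope to `‖h‖² - ‖C h‖²`. Hence `V
h ↦ W h` is isometric, and in finite dimension it extends to a unitary `U`
(`exists_unitary_of_norm_eq`). The same identity and `C^m → 0` make `h ↦ ∑ z^k W C^k h` an isometry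
into the Hardy space (`exists_isometry_orbit`). The intertwining relations, read coefficientwise,
only say that gluing components of `W` and `W C`, or of `V` and `V C`, gives `V T₁^*` or `W T₂^*`.

Both products of the symbols equal `z`, so the model operators commute.

Purity is the delicate point. On coefficients `M_Φ^* = A + B S^*` with `S` the shift and `A = U P`;
such a contraction is strongly stable once `‖A^n‖ → 0` (`tendsto_pow_lpAmp_add_backward`). In finite
dimension this can fail only through a unimodular eigenvalue, whose eigenvector is an eigenvector of
`U` in the range of `P`. Pairing it with `U V = W` and iterating contradicts the purity of `T₁`
(`eq_zero_of_inner_defectVec_eq`). For `M_Ψ` the roles of `P`, `P^⊥` and of `T₁`, `T₂` are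
exchanged. -/

theorem tendsto_norm_pow_zero_of_spectralRadius_lt_one {A : Type*} [NormedRing A]
    [NormedAlgebra ℂ A] [CompleteSpace A] {a : A} (ha : spectralRadius ℂ a < 1) :
    Tendsto (fun n : ℕ => ‖a ^ n‖) atTop (𝓝 0) := by
  obtain ⟨r, har, hr⟩ := ENNReal.lt_iff_exists_nnreal_btwn.1 ha
  have hr1 : (r : ℝ) < 1 := by exact_mod_cast hr
  refine squeeze_zero' (Eventually.of_forall fun _ => norm_nonneg _) ?_
    (tendsto_pow_atTop_nhds_zero_of_lt_one r.2 hr1)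
  -- Gelfand's formula: eventually `‖a ^ n‖ ^ (1 / n) < r`, hence `‖a ^ n‖ ≤ r ^ n`.
  filter_upwards [(spectrum.pow_nnnorm_pow_one_div_tendsto_nhds_spectralRadius a).eventually_lt_const
    har, eventually_gt_atTop 0] with n hn hn0
  have h1 : ((‖a ^ n‖₊ : ENNReal) ^ (1 / n : ℝ)) ^ (n : ℝ) ≤ (r : ENNReal) ^ (n : ℝ) :=
    ENNReal.rpow_le_rpow hn.le (by positivity)
  rw [← ENNReal.rpow_mul, one_div_mul_cancel (by positivity), ENNReal.rpow_one,
    ENNReal.rpow_natCast] at h1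
  exact_mod_cast h1

/-- The powers of a contraction on a finite-dimensional space without unimodular eigenvalues tend
to zero. -/
theorem tendsto_norm_pow_zero_of_no_unimodular_eigenvalue [FiniteDimensional ℂ E]
    (A : E →L[ℂ] E) (hA : ‖A‖ ≤ 1)
    (h : ∀ (c : ℂ) (x : E), ‖c‖ = 1 → A x = c • x → x = 0) :
    Tendsto (fun n : ℕ => ‖A ^ n‖) atTop (𝓝 0) := by
  have : CompleteSpace E := FiniteDimensional.complete ℂ E
  rcases subsingleton_or_nontrivial E with hE | hE
  · have : ∀ n : ℕ, A ^ n = 0 := fun n => Subsingleton.elim _ _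
    simp [this]
  refine tendsto_norm_pow_zero_of_spectralRadius_lt_one ?_
  refine spectrum.spectralRadius_lt_of_forall_lt A (r := 1) fun c hc => ?_
  have hc1 : ‖c‖ ≤ 1 := (spectrum.norm_le_norm_of_mem hc).trans hA
  refine lt_of_le_of_ne hc1 fun hc2 => ?_
  -- Invertibility means bijectivity in both algebras, so `c` is in the spectrum of the linear map,
  -- which in finite dimension consists of eigenvalues.
  have hc' : c ∈ spectrum ℂ (A : E →ₗ[ℂ] E) := by
    rw [spectrum.mem_iff] at hc ⊢
    intro hu
    apply hc
    rw [Module.End.isUnit_iff] at hu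
    rw [ContinuousLinearMap.isUnit_iff_bijective]
    exact hu
  obtain ⟨x, hx⟩ := (Module.End.hasEigenvalue_iff_mem_spectrum.2 hc').exists_hasEigenvector
  exact hx.2 (h c x (congrArg NNReal.toReal hc2) hx.apply_eq_smul)

/-- An orthogonal projection fixes the vectors whose norm it does not decrease. -/
theorem projection_apply_eq_self_of_norm_le [CompleteSpace E] {Q : E →L[ℂ] E}
    (hQ : IsStarProjection Q) {x : E} (hx : ‖x‖ ≤ ‖Q x‖) : Q x = x := by
  have hQQ : Q (Q x) = Q x := congrArg (fun R : E →L[ℂ] E => R x) hQ.isIdempotentElem.eq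
  have horth : ⟪Q x, x - Q x⟫_ℂ = 0 := by
    have hs : adjoint Q = Q := hQ.isSelfAdjoint
    rw [← adjoint_inner_right, hs, map_sub, hQQ, sub_self, inner_zero_right]
  have hpyth := norm_add_sq_eq_norm_sq_add_norm_sq_of_inner_eq_zero (Q x) (x - Q x) horth
  rw [add_sub_cancel] at hpyth
  have : ‖x - Q x‖ = 0 := by
    nlinarith [norm_nonneg (x - Q x), norm_nonneg x, norm_nonneg (Q x)]
  exact (sub_eq_zero.1 (norm_eq_zero.1 this)).symm

/-- If a unitary `U` has no eigenvector in the range of the projection `Q`, then the powers of the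
compression `U Q` tend to zero. -/
theorem tendsto_norm_pow_mul_projection [FiniteDimensional ℂ E] [CompleteSpace E]
    {U Q : E →L[ℂ] E} (hU : U ∈ unitary (E →L[ℂ] E)) (hQ : IsStarProjection Q)
    (h : ∀ (c : ℂ) (x : E), ‖c‖ = 1 → Q x = x → U x = c • x → x = 0) :
    Tendsto (fun n : ℕ => ‖(U * Q) ^ n‖) atTop (𝓝 0) := by
  have hUn : ∀ x, ‖U x‖ = ‖x‖ := fun x =>
    (ContinuousLinearMap.norm_map_iff_adjoint_comp_self U).2 (Unitary.star_mul_self_of_mem hU) x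
  refine tendsto_norm_pow_zero_of_no_unimodular_eigenvalue _ ?_ fun c x hc hx => ?_
  · refine ContinuousLinearMap.opNorm_le_bound _ zero_le_one fun x => ?_
    rw [mul_apply_eq_comp, hUn]
    exact Q.le_of_opNorm_le hQ.norm_le x
  · rw [mul_apply_eq_comp] at hx
    -- `‖Q x‖ = ‖U Q x‖ = ‖c x‖ = ‖x‖`.
    have hQx : Q x = x := projection_apply_eq_self_of_norm_le hQ <| by
      rw [← hUn (Q x), hx, norm_smul, hc, one_mul]
    exact h c x hc hQx (by rwa [hQx] at hx)

end Powers

/-! ### Constant symbols and the shift on the Hardy space -/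

section SquareSummable

variable {E : Type*} [NormedAddCommGroup E]

theorem memlp_two_iff_summable (f : ℕ → E) : Memℓp f 2 ↔ Summable fun k => ‖f k‖ ^ 2 := by
  rw [memℓp_gen_iff (by norm_num)]
  norm_num

theorem lp_two_norm_sq_eq_tsum (f : lp (fun _ : ℕ => E) 2) : ‖f‖ ^ 2 = ∑' k, ‖f k‖ ^ 2 := by
  have h := lp.norm_rpow_eq_tsum (p := 2) (by norm_num) f
  norm_num at h
  exact h

theorem summable_lp_two_norm_sq (f : lp (fun _ : ℕ => E) 2) : Summable fun k => ‖f k‖ ^ 2 :=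
  (memlp_two_iff_summable _).1 (lp.memℓp f)

end SquareSummable

section HardyOperators

variable {E : Type*} [NormedAddCommGroup E] [InnerProductSpace ℂ E]

/-- The coordinatewise action of an operator on square-summable sequences. -/
def lpAmp (A : E →L[ℂ] E) : lp (fun _ : ℕ => E) 2 →L[ℂ] lp (fun _ : ℕ => E) 2 :=
  have hb : ∀ (f : lp (fun _ : ℕ => E) 2) k, ‖A (f k)‖ ^ 2 ≤ ‖A‖ ^ 2 * ‖f k‖ ^ 2 := fun f k => by
    rw [← mul_pow]
    exact pow_le_pow_left₀ (norm_nonneg _) (A.le_opNorm _) 2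
  have hs : ∀ f : lp (fun _ : ℕ => E) 2, Summable fun k => ‖A (f k)‖ ^ 2 := fun f =>
    Summable.of_nonneg_of_le (fun _ => by positivity) (hb f)
      ((summable_lp_two_norm_sq f).mul_left _)
  LinearMap.mkContinuous
    { toFun := fun f => ⟨fun k => A (f k), (memlp_two_iff_summable _).2 (hs f)⟩
      map_add' := fun f g => by ext k; exact map_add A _ _
      map_smul' := fun c f => by ext k; simp } ‖A‖ <| fun f => by
    refine le_of_sq_le_sq ?_ (by positivity)
    rw [mul_pow, lp_two_norm_sq_eq_tsum, lp_two_norm_sq_eq_tsum f, ← tsum_mul_left]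
    exact (hs f).tsum_le_tsum (hb f) ((summable_lp_two_norm_sq f).mul_left _)

@[simp]
theorem lpAmp_apply (A : E →L[ℂ] E) (f : lp (fun _ : ℕ => E) 2) (k : ℕ) :
    lpAmp A f k = A (f k) := rfl

theorem lpAmp_mul (A B : E →L[ℂ] E) : lpAmp (A * B) = lpAmp A * lpAmp B := by
  ext f k; simp

theorem lpAmp_one : lpAmp (1 : E →L[ℂ] E) = 1 := by
  ext f k; simp

theorem lpAmp_sub (A B : E →L[ℂ] E) : lpAmp (A - B) = lpAmp A - lpAmp B := by
  ext f k; simp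

theorem lpAmp_single (A : E →L[ℂ] E) (k : ℕ) (x : E) :
    lpAmp A (lp.single 2 k x) = lp.single 2 k (A x) := by
  ext j
  rcases eq_or_ne j k with rfl | h
  · simp
  · simp [h]

theorem adjoint_lpAmp [CompleteSpace E] (A : E →L[ℂ] E) :
    adjoint (lpAmp A) = lpAmp (adjoint A) := by
  symm
  rw [eq_adjoint_iff]
  intro f g
  simp [lp.inner_eq_tsum, adjoint_inner_left]

variable (E) in
/-- The forward shift on square-summable sequences. -/
def lpShift : lp (fun _ : ℕ => E) 2 →ₗᵢ[ℂ] lp (fun _ : ℕ => E) 2 where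
  toFun f := ⟨fun k => Nat.casesOn k 0 fun j => f j, by
    refine (memlp_two_iff_summable _).2 ((summable_nat_add_iff 1).1 ?_)
    exact summable_lp_two_norm_sq f⟩
  map_add' f g := by
    ext k
    cases k
    · exact (add_zero _).symm
    · rfl
  map_smul' c f := by
    ext k
    cases k <;> simp
  norm_map' f := by
    rw [← sq_eq_sq₀ (norm_nonneg _) (norm_nonneg _), lp_two_norm_sq_eq_tsum,
      lp_two_norm_sq_eq_tsum f, Summable.tsum_eq_zero_add]
    · simp
    · rw [← summable_nat_add_iff 1]
      exact summable_lp_two_norm_sq f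

@[simp]
theorem lpShift_apply_zero (f : lp (fun _ : ℕ => E) 2) : lpShift E f 0 = 0 := rfl

@[simp]
theorem lpShift_apply_succ (f : lp (fun _ : ℕ => E) 2) (k : ℕ) :
    lpShift E f (k + 1) = f k := rfl

theorem lpShift_single (k : ℕ) (x : E) :
    lpShift E (lp.single 2 k x) = lp.single 2 (k + 1) x := by
  ext j
  cases j with
  | zero => simp
  | succ j =>
    rcases eq_or_ne j k with rfl | h
    · simp
    · simp [h]

variable (E) in
/-- The forward shift as a bounded operator. -/
abbrev lpShiftCLM : lp (fun _ : ℕ => E) 2 →L[ℂ] lp (fun _ : ℕ => E) 2 :=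
  (lpShift E).toContinuousLinearMap

theorem commute_lpAmp_lpShift (A : E →L[ℂ] E) : lpAmp A * lpShiftCLM E =
    lpShiftCLM E * lpAmp A := by
  ext f k
  cases k <;> simp

variable [CompleteSpace E]

@[simp]
theorem adjoint_lpShift_apply (f : lp (fun _ : ℕ => E) 2) (k : ℕ) :
    adjoint (lpShiftCLM E) f k = f (k + 1) := by
  refine ext_inner_left ℂ fun x => ?_
  rw [← lp.inner_single_left (G := fun _ : ℕ => E) k x, adjoint_inner_right]
  change ⟪lpShift E _, f⟫_ℂ = _
  rw [lpShift_single, lp.inner_single_left]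

theorem adjoint_lpShift_single_zero (x : E) :
    adjoint (lpShiftCLM E) (lp.single 2 0 x) = 0 := by
  ext j
  simp

theorem adjoint_lpShift_single_succ (k : ℕ) (x : E) :
    adjoint (lpShiftCLM E) (lp.single 2 (k + 1) x) = lp.single 2 k x := by
  ext j
  rcases eq_or_ne j k with rfl | h
  · simp
  · simp [h]

theorem adjoint_lpShift_mul_self : adjoint (lpShiftCLM E) * lpShiftCLM E = 1 := by
  ext f k
  simp

end HardyOperators

/-! ### The algebra of the BCL symbols -/

section SymbolAlgebra

variable {R : Type*} [Ring R] {p s : R}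

/-- Since `p (1 - p) = 0` and `s` commutes with `p`, only `s p + s (1 - p)` survives. Here `p`
stands for the projection and `s` for the shift. -/
theorem bcl_mul_eq_shift (hp : p * p = p) (hs : p * s = s * p) :
    (p + s * (1 - p)) * ((1 - p) + s * p) = s := by
  have h2 : ∀ x, p * (s * x) = s * (p * x) := fun x => by rw [← mul_assoc, hs, mul_assoc]
  simp only [mul_add, add_mul, mul_sub, sub_mul, mul_one, mul_assoc, hp, h2]
  abel

theorem bcl_mul_eq_shift' (hp : p * p = p) (hs : p * s = s * p) :
    ((1 - p) + s * p) * (p + s * (1 - p)) = s := by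
  have h2 : ∀ x, p * (s * x) = s * (p * x) := fun x => by rw [← mul_assoc, hs, mul_assoc]
  simp only [mul_add, add_mul, mul_sub, sub_mul, mul_one, one_mul, mul_assoc, hp, hs, h2]
  abel

theorem bcl_star_mul_self [StarRing R] (hp : p * p = p) (hps : star p = p)
    (hs : p * s = s * p) (hss : star s * s = 1) :
    star (p + s * (1 - p)) * (p + s * (1 - p)) = 1 := by
  have hs' : p * star s = star s * p := by
    have := congrArg star hs
    simpa [hps] using this.symm
  have h2 : ∀ x, p * (s * x) = s * (p * x) := fun x => by rw [← mul_assoc, hs, mul_assoc]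
  have h4 : ∀ x, star s * (s * x) = x := fun x => by rw [← mul_assoc, hss, one_mul]
  simp only [star_add, star_mul, star_sub, hps, mul_add, add_mul, mul_sub, sub_mul,
    mul_one, mul_assoc, hp, hs, hs', h2, h4, hss]
  abel

end SymbolAlgebra

/-! ### Strong convergence to zero of powers -/

section StrongStability

variable {K : Type*} [NormedAddCommGroup K] [InnerProductSpace ℂ K]

theorem norm_pow_apply_le {C : K →L[ℂ] K} (hC : ‖C‖ ≤ 1) (m : ℕ) (f : K) :
    ‖(C ^ m) f‖ ≤ ‖f‖ := by
  induction m with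
  | zero => simp
  | succ m ih =>
    rw [pow_succ', mul_apply_eq_comp]
    exact (C.le_of_opNorm_le hC _).trans (by simpa using ih)

/-- The vectors whose orbit under the powers of a contraction tends to zero form a closed
subspace. -/
def stableSubspace (C : K →L[ℂ] K) : Submodule ℂ K where
  carrier := {f | Tendsto (fun m : ℕ => (C ^ m) f) atTop (𝓝 0)}
  add_mem' {f g} hf hg := by
    have := Tendsto.add hf hg
    simpa using this
  zero_mem' := by simp
  smul_mem' c f hf := by
    have := Tendsto.const_smul hf c
    rw [smul_zero] at this
    simpa only [Set.mem_ofPred_eq, map_smul] using this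

theorem mem_stableSubspace {C : K →L[ℂ] K} {f : K} :
    f ∈ stableSubspace C ↔ Tendsto (fun m : ℕ => (C ^ m) f) atTop (𝓝 0) := Iff.rfl

/-- A vector lies in the stable subspace of a contraction as soon as its orbit comes arbitrarily
close to that subspace. -/
theorem mem_stableSubspace_of_approx {C : K →L[ℂ] K} (hC : ‖C‖ ≤ 1) {f : K}
    (h : ∀ ε > 0, ∃ j : ℕ, ∃ g ∈ stableSubspace C, ‖(C ^ j) f - g‖ < ε) :
    f ∈ stableSubspace C := by
  rw [mem_stableSubspace, Metric.tendsto_atTop]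
  intro ε hε
  obtain ⟨j, g, hg, hfg⟩ := h (ε / 2) (half_pos hε)
  obtain ⟨N, hN⟩ := Metric.tendsto_atTop.1 (mem_stableSubspace.1 hg) (ε / 2) (half_pos hε)
  refine ⟨N + j, fun m hm => ?_⟩
  obtain ⟨l, rfl⟩ := Nat.exists_eq_add_of_le' (le_of_add_le_right hm)
  have hl := hN l (by omega)
  rw [dist_zero_right] at hl ⊢
  have heq : (C ^ (l + j)) f = (C ^ l) ((C ^ j) f - g) + (C ^ l) g := by
    rw [map_sub, sub_add_cancel, pow_add, mul_apply_eq_comp]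
  rw [heq]
  have h1 := norm_pow_apply_le hC l ((C ^ j) f - g)
  have h2 := norm_add_le ((C ^ l) ((C ^ j) f - g)) ((C ^ l) g)
  linarith

variable {E : Type*} [NormedAddCommGroup E] [InnerProductSpace ℂ E] [CompleteSpace E]

/-- A contraction `A + B S^*` on square-summable sequences is strongly stable if the powers of `A`
tend to zero in norm. -/
theorem tendsto_pow_lpAmp_add_backward (A B : E →L[ℂ] E)
    (hC : ‖lpAmp A + lpAmp B * adjoint (lpShiftCLM E)‖ ≤ 1)
    (hA : Tendsto (fun n : ℕ => ‖A ^ n‖) atTop (𝓝 0)) (f : lp (fun _ : ℕ => E) 2) :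
    Tendsto (fun m : ℕ => ((lpAmp A + lpAmp B * adjoint (lpShiftCLM E)) ^ m) f) atTop (𝓝 0) := by
  set C := lpAmp A + lpAmp B * adjoint (lpShiftCLM E) with hCdef
  have hCN : ∀ g ∈ stableSubspace C, C g ∈ stableSubspace C := fun g hg => by
    rw [mem_stableSubspace] at hg ⊢
    have := (tendsto_add_atTop_iff_nat 1).2 hg
    simpa only [pow_succ, mul_apply_eq_comp] using this
  -- Induction on the degree: `C` acts as `A` in degree `0`, and sends degree `k + 1` to `A` in the
  -- same degree plus a term in degree `k`.
  have key : ∀ (k : ℕ) (x : E), lp.single 2 k x ∈ stableSubspace C := by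
    intro k
    induction k with
    | zero =>
      intro x
      have hpow : ∀ j : ℕ, (C ^ j) (lp.single 2 0 x) = lp.single 2 0 ((A ^ j) x) := by
        intro j
        induction j with
        | zero => simp
        | succ j ih =>
          rw [pow_succ', mul_apply_eq_comp, ih, hCdef, add_apply, mul_apply_eq_comp,
            adjoint_lpShift_single_zero, map_zero, add_zero, lpAmp_single, pow_succ' A,
            mul_apply_eq_comp]
      rw [mem_stableSubspace, tendsto_zero_iff_norm_tendsto_zero]
      refine squeeze_zero (fun _ => norm_nonneg _) (fun m => ?_) (by simpa using hA.mul_const ‖x‖)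
      rw [hpow, lp.norm_single (by norm_num)]
      exact (A ^ m).le_opNorm x
    | succ k ih =>
      intro x
      -- Modulo stable vectors `C ^ j` acts as `A ^ j` in the top degree; since `A ^ j x → 0`, the
      -- orbit approaches the stable subspace.
      have hpow : ∀ j : ℕ, (C ^ j) (lp.single 2 (k + 1) x) - lp.single 2 (k + 1) ((A ^ j) x) ∈
          stableSubspace C := by
        intro j
        induction j with
        | zero => simp
        | succ j ihj =>
          have h1 := hCN _ ihj
          have h2 := ih (B ((A ^ j) x))
          have h3 := (stableSubspace C).add_mem h1 h2
          convert h3 using 1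
          rw [map_sub, pow_succ', mul_apply_eq_comp]
          have : C (lp.single 2 (k + 1) ((A ^ j) x)) =
              lp.single 2 (k + 1) ((A ^ (j + 1)) x) + lp.single 2 k (B ((A ^ j) x)) := by
            rw [hCdef, add_apply, mul_apply_eq_comp, adjoint_lpShift_single_succ, lpAmp_single,
              lpAmp_single, pow_succ' A, mul_apply_eq_comp]
          rw [this]
          abel
      refine mem_stableSubspace_of_approx hC fun ε hε => ?_
      have hAx : Tendsto (fun n : ℕ => ‖A ^ n‖ * ‖x‖) atTop (𝓝 0) := by
        simpa using hA.mul_const ‖x‖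
      obtain ⟨j, hj⟩ := (hAx.eventually_lt_const hε).exists
      refine ⟨j, _, hpow j, ?_⟩
      rw [sub_sub_cancel, lp.norm_single (by norm_num)]
      exact ((A ^ j).le_opNorm x).trans_lt hj
  refine mem_stableSubspace.1 (mem_stableSubspace_of_approx hC fun ε hε => ?_)
  have hsum := lp.hasSum_single (p := 2) (by norm_num) f
  obtain ⟨s, hs⟩ := (Metric.tendsto_nhds.1 hsum ε hε).exists
  -- No iteration is needed here: finitely supported sequences are dense.
  refine ⟨0, ∑ i ∈ s, lp.single 2 i (f i), (stableSubspace C).sum_mem fun i _ => key i (f i), ?_⟩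
  rw [dist_comm, dist_eq_norm] at hs
  simpa using hs

end StrongStability

/-! ### The model operators -/

section Model

variable {E : Type*} [NormedAddCommGroup E] [InnerProductSpace ℂ E] [CompleteSpace E]

/-- The operator on coefficient sequences induced by the symbol `Φ`. -/
def BCLTriple.lpPhi (B : BCLTriple E) : lp (fun _ : ℕ => E) 2 →L[ℂ] lp (fun _ : ℕ => E) 2 :=
  (lpAmp B.P + lpShiftCLM E * (1 - lpAmp B.P)) * lpAmp (adjoint B.U)

/-- The operator on coefficient sequences induced by the symbol `Ψ`. -/
def BCLTriple.lpPsi (B : BCLTriple E) : lp (fun _ : ℕ => E) 2 →L[ℂ] lp (fun _ : ℕ => E) 2 :=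
  lpAmp B.U * ((1 - lpAmp B.P) + lpShiftCLM E * lpAmp B.P)

theorem BCLTriple.lpAmp_P_mul_self (B : BCLTriple E) : lpAmp B.P * lpAmp B.P = lpAmp B.P := by
  rw [← lpAmp_mul, B.projection_P.isIdempotentElem.eq]

theorem BCLTriple.star_lpAmp_P (B : BCLTriple E) : star (lpAmp B.P) = lpAmp B.P := by
  rw [star_eq_adjoint, adjoint_lpAmp, ← star_eq_adjoint, B.projection_P.isSelfAdjoint.star_eq]

theorem BCLTriple.lpAmp_adjoint_U_mul (B : BCLTriple E) :
    lpAmp (adjoint B.U) * lpAmp B.U = 1 := by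
  rw [← lpAmp_mul, ← star_eq_adjoint, Unitary.star_mul_self_of_mem B.unitary_U, lpAmp_one]

theorem BCLTriple.lpAmp_U_mul_adjoint (B : BCLTriple E) :
    lpAmp B.U * lpAmp (adjoint B.U) = 1 := by
  rw [← lpAmp_mul, ← star_eq_adjoint, Unitary.mul_star_self_of_mem B.unitary_U, lpAmp_one]

/-- Both products are the shift: in one order `U^* U` cancels in the middle, in the other `U` moves
past the shift and meets `U^*`. -/
theorem BCLTriple.commute_lp (B : BCLTriple E) : Commute B.lpPhi B.lpPsi := by
  have h1 : B.lpPhi * B.lpPsi = lpShiftCLM E := by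
    rw [lpPhi, lpPsi, mul_assoc, ← mul_assoc (lpAmp (adjoint B.U)), B.lpAmp_adjoint_U_mul, one_mul,
      bcl_mul_eq_shift B.lpAmp_P_mul_self (commute_lpAmp_lpShift _)]
  have h2 : B.lpPsi * B.lpPhi = lpShiftCLM E := by
    rw [lpPhi, lpPsi, mul_assoc, ← mul_assoc (_ + _) (_ + _),
      bcl_mul_eq_shift' B.lpAmp_P_mul_self (commute_lpAmp_lpShift _), ← commute_lpAmp_lpShift,
      ← mul_assoc, B.lpAmp_U_mul_adjoint, one_mul]
  exact h1.trans h2.symm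

theorem BCLTriple.star_lpPhi_mul_self (B : BCLTriple E) : star B.lpPhi * B.lpPhi = 1 := by
  rw [lpPhi, star_mul, mul_assoc, ← mul_assoc (star (_ + _)),
    bcl_star_mul_self B.lpAmp_P_mul_self B.star_lpAmp_P (commute_lpAmp_lpShift _)
      adjoint_lpShift_mul_self, one_mul, star_eq_adjoint, adjoint_lpAmp, adjoint_adjoint,
    B.lpAmp_U_mul_adjoint]

theorem BCLTriple.star_lpPsi_mul_self (B : BCLTriple E) : star B.lpPsi * B.lpPsi = 1 := by
  -- The inner factor of `Ψ` is that of `Φ` with `P` replaced by `1 - P`.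
  have h := bcl_star_mul_self (p := 1 - lpAmp B.P) (s := lpShiftCLM E)
    (by simp [mul_sub, sub_mul, B.lpAmp_P_mul_self]) (by simp [B.star_lpAmp_P])
    (by rw [sub_mul, mul_sub, commute_lpAmp_lpShift, one_mul, mul_one]) adjoint_lpShift_mul_self
  rw [sub_sub_cancel] at h
  rw [lpPsi, star_mul, mul_assoc, ← mul_assoc (star (lpAmp B.U)), star_eq_adjoint (lpAmp B.U),
    adjoint_lpAmp, B.lpAmp_adjoint_U_mul, one_mul, h]

/-- This is the form `A + B S^*` required by the stability criterion. -/
theorem BCLTriple.adjoint_lpPhi (B : BCLTriple E) :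
    adjoint B.lpPhi = lpAmp (B.U * B.P) + lpAmp (B.U * (1 - B.P)) * adjoint (lpShiftCLM E) := by
  have hP := B.star_lpAmp_P
  rw [← star_eq_adjoint, lpPhi, star_mul, star_add, star_mul, star_sub, star_one, hP,
    star_eq_adjoint (lpAmp (adjoint B.U)), adjoint_lpAmp, adjoint_adjoint, lpAmp_mul, lpAmp_mul,
    lpAmp_sub, lpAmp_one, mul_add, star_eq_adjoint, mul_assoc]

theorem BCLTriple.adjoint_lpPsi (B : BCLTriple E) :
    adjoint B.lpPsi = lpAmp ((1 - B.P) * adjoint B.U) +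
      lpAmp (B.P * adjoint B.U) * adjoint (lpShiftCLM E) := by
  have hP := B.star_lpAmp_P
  have hc : adjoint (lpShiftCLM E) * lpAmp (adjoint B.U) =
      lpAmp (adjoint B.U) * adjoint (lpShiftCLM E) := by
    ext f k
    simp
  rw [← star_eq_adjoint, lpPsi, star_mul, star_add, star_mul, star_sub, star_one, hP,
    star_eq_adjoint (lpAmp B.U), adjoint_lpAmp, lpAmp_mul, lpAmp_mul, lpAmp_sub,
    lpAmp_one, add_mul, star_eq_adjoint, mul_assoc (lpAmp B.P), mul_assoc (lpAmp B.P), hc]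

theorem BCLTriple.adjoint_lpPhi_apply (B : BCLTriple E) (f : lp (fun _ : ℕ => E) 2) (k : ℕ) :
    adjoint B.lpPhi f k = B.U (B.P (f k) + (f (k + 1) - B.P (f (k + 1)))) := by
  rw [B.adjoint_lpPhi, map_add, ← adjoint_lpShift_apply f]
  rfl

theorem BCLTriple.adjoint_lpPsi_apply (B : BCLTriple E) (f : lp (fun _ : ℕ => E) 2) (k : ℕ) :
    adjoint B.lpPsi f k =
      adjoint B.U (f k) - B.P (adjoint B.U (f k)) + B.P (adjoint B.U (f (k + 1))) := by
  rw [B.adjoint_lpPsi, ← adjoint_lpShift_apply f]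
  rfl

theorem BCLTriple.adjoint_U_apply_U (B : BCLTriple E) (x : E) : adjoint B.U (B.U x) = x :=
  congrArg (fun R : E →L[ℂ] E => R x) (Unitary.star_mul_self_of_mem B.unitary_U)

theorem isometry_of_star_mul_self {K : Type*} [NormedAddCommGroup K] [InnerProductSpace ℂ K]
    [CompleteSpace K] {V : K →L[ℂ] K} (hV : star V * V = 1) : Isometry V :=
  AddMonoidHomClass.isometry_of_norm V
    ((ContinuousLinearMap.norm_map_iff_adjoint_comp_self V).2 hV)

theorem norm_le_one_of_isometry {K : Type*} [NormedAddCommGroup K] [InnerProductSpace ℂ K]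
    {V : K →L[ℂ] K} (hV : Isometry V) : ‖V‖ ≤ 1 :=
  V.opNorm_le_bound zero_le_one fun x => by
    rw [one_mul, hV.norm_map_of_map_zero (map_zero V)]

theorem BCLTriple.isPureIsometry_lpPhi (B : BCLTriple E)
    (h : Tendsto (fun n : ℕ => ‖(B.U * B.P) ^ n‖) atTop (𝓝 0)) : IsPureIsometry B.lpPhi := by
  have hi := isometry_of_star_mul_self B.star_lpPhi_mul_self
  have h1 := norm_le_one_of_isometry hi
  refine ⟨hi, h1, fun f => ?_⟩
  have h2 : ‖adjoint B.lpPhi‖ ≤ 1 := by rwa [LinearIsometryEquiv.norm_map]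
  rw [B.adjoint_lpPhi] at h2 ⊢
  exact tendsto_zero_iff_norm_tendsto_zero.1 (tendsto_pow_lpAmp_add_backward _ _ h2 h f)

theorem BCLTriple.isPureIsometry_lpPsi (B : BCLTriple E)
    (h : Tendsto (fun n : ℕ => ‖(B.U * (1 - B.P)) ^ n‖) atTop (𝓝 0)) :
    IsPureIsometry B.lpPsi := by
  have hi := isometry_of_star_mul_self B.star_lpPsi_mul_self
  have h1 := norm_le_one_of_isometry hi
  refine ⟨hi, h1, fun f => ?_⟩
  have h2 : ‖adjoint B.lpPsi‖ ≤ 1 := by rwa [LinearIsometryEquiv.norm_map]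
  -- Taking stars preserves the norms of powers, so the hypothesis can have the form unitary times
  -- projection.
  have h3 : (1 - B.P) * adjoint B.U = star (B.U * (1 - B.P)) := by
    rw [star_mul, star_sub, star_one, B.projection_P.isSelfAdjoint.star_eq, star_eq_adjoint]
  rw [B.adjoint_lpPsi] at h2 ⊢
  refine tendsto_zero_iff_norm_tendsto_zero.1 (tendsto_pow_lpAmp_add_backward _ _ h2 ?_ f)
  simpa only [h3, ← star_pow, norm_star] using h

/-! ### Transfer to the Hardy space -/

theorem powerSeriesMap_apply (f : lp (fun _ : ℕ => E) 2) (z : Complex.UnitDisc) :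
    powerSeriesMap E f z = ∑' k : ℕ, (z : ℂ) ^ k • f k := rfl

theorem powerSeriesMap_lpAmp (A : E →L[ℂ] E) (f : lp (fun _ : ℕ => E) 2)
    (z : Complex.UnitDisc) : powerSeriesMap E (lpAmp A f) z = A (powerSeriesMap E f z) := by
  rw [powerSeriesMap_apply, powerSeriesMap_apply, A.map_tsum (summable_pow_smul f z)]
  simp

theorem powerSeriesMap_lpShift (f : lp (fun _ : ℕ => E) 2) (z : Complex.UnitDisc) :
    powerSeriesMap E (lpShiftCLM E f) z = (z : ℂ) • powerSeriesMap E f z := by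
  rw [powerSeriesMap_apply, powerSeriesMap_apply, ← (summable_pow_smul f z).tsum_const_smul,
    (summable_pow_smul (lpShiftCLM E f) z).tsum_eq_zero_add]
  simp [pow_succ', mul_smul]

/-- The operator on the Hardy space with the given action on Taylor coefficients. -/
def hardyConj (X : lp (fun _ : ℕ => E) 2 →L[ℂ] lp (fun _ : ℕ => E) 2) :
    HardySpace E →L[ℂ] HardySpace E :=
  (HardySpace.coeffIsometry E).symm.conjStarAlgEquiv X

theorem hardyConj_apply (X : lp (fun _ : ℕ => E) 2 →L[ℂ] lp (fun _ : ℕ => E) 2)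
    (f : HardySpace E) : hardyConj X f =
      (HardySpace.coeffIsometry E).symm (X (HardySpace.coeffIsometry E f)) := rfl

theorem coeffIsometry_symm_apply (f : lp (fun _ : ℕ => E) 2) (z : Complex.UnitDisc) :
    (HardySpace.coeffIsometry E).symm f z = powerSeriesMap E f z := rfl

theorem powerSeriesMap_coeffIsometry (f : HardySpace E) (z : Complex.UnitDisc) :
    powerSeriesMap E (HardySpace.coeffIsometry E f) z = f z := by
  rw [← coeffIsometry_symm_apply, LinearIsometryEquiv.symm_apply_apply]

theorem adjoint_hardyConj (X : lp (fun _ : ℕ => E) 2 →L[ℂ] lp (fun _ : ℕ => E) 2) :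
    adjoint (hardyConj X) = hardyConj (adjoint X) :=
  ((HardySpace.coeffIsometry E).symm.conjStarAlgEquiv.map_star' X).symm

theorem Commute.hardyConj {X Y : lp (fun _ : ℕ => E) 2 →L[ℂ] lp (fun _ : ℕ => E) 2}
    (h : Commute X Y) : Commute (hardyConj X) (hardyConj Y) :=
  h.map (HardySpace.coeffIsometry E).symm.conjStarAlgEquiv

theorem hardyConj_pow (X : lp (fun _ : ℕ => E) 2 →L[ℂ] lp (fun _ : ℕ => E) 2) (m : ℕ) :
    hardyConj X ^ m = hardyConj (X ^ m) :=
  (map_pow (HardySpace.coeffIsometry E).symm.conjStarAlgEquiv X m).symm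

theorem IsPureIsometry.hardyConj {X : lp (fun _ : ℕ => E) 2 →L[ℂ] lp (fun _ : ℕ => E) 2}
    (h : IsPureIsometry X) : IsPureIsometry (hardyConj X) := by
  have hi : Isometry (PureDilation.hardyConj X) :=
    (HardySpace.coeffIsometry E).symm.isometry.comp
      (h.1.comp (HardySpace.coeffIsometry E).isometry)
  refine ⟨hi, norm_le_one_of_isometry hi, fun f => ?_⟩
  have := h.2.2 (HardySpace.coeffIsometry E f)
  simpa only [adjoint_hardyConj, hardyConj_pow, hardyConj_apply, LinearIsometryEquiv.norm_map]
    using this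

theorem BCLTriple.isMulOperator_lpPhi (B : BCLTriple E) :
    IsMulOperator B.symbolPhi (hardyConj B.lpPhi) := by
  intro f z
  rw [hardyConj_apply, coeffIsometry_symm_apply, lpPhi, mul_apply_eq_comp, add_apply,
    map_add, Pi.add_apply, mul_apply_eq_comp, powerSeriesMap_lpShift, ← lpAmp_one, ← lpAmp_sub,
    powerSeriesMap_lpAmp, powerSeriesMap_lpAmp, powerSeriesMap_lpAmp, powerSeriesMap_lpAmp,
    powerSeriesMap_coeffIsometry]
  rfl

theorem BCLTriple.isMulOperator_lpPsi (B : BCLTriple E) :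
    IsMulOperator B.symbolPsi (hardyConj B.lpPsi) := by
  intro f z
  rw [hardyConj_apply, coeffIsometry_symm_apply, lpPsi, mul_apply_eq_comp, powerSeriesMap_lpAmp,
    add_apply, map_add, Pi.add_apply, mul_apply_eq_comp, powerSeriesMap_lpShift, ← lpAmp_one,
    ← lpAmp_sub, powerSeriesMap_lpAmp, powerSeriesMap_lpAmp, powerSeriesMap_coeffIsometry]
  rfl

end Model

/-! ### Defect operators -/

section Defect

variable {H : Type*} [NormedAddCommGroup H] [InnerProductSpace ℂ H] [CompleteSpace H]

/-- The defect operator with values in the defect space, as a linear map. -/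
def defectVecLinear (T : H →L[ℂ] H) : H →ₗ[ℂ] defectSpace T :=
  (defectOp T : H →ₗ[ℂ] H).codRestrict _ fun h => (defectVec T h).2

theorem norm_defectVec_sq (T : H →L[ℂ] H) (hT : ‖T‖ ≤ 1) (h : H) :
    ‖defectVec T h‖ ^ 2 = ‖h‖ ^ 2 - ‖T h‖ ^ 2 := by
  have hs : adjoint (defectOp T) = defectOp T := (defectOp_nonneg T).isSelfAdjoint
  have h1 : ⟪defectOp T h, defectOp T h⟫_ℂ = ⟪h, h⟫_ℂ - ⟪T h, T h⟫_ℂ := by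
    calc ⟪defectOp T h, defectOp T h⟫_ℂ = ⟪h, (defectOp T * defectOp T) h⟫_ℂ := by
          rw [mul_apply_eq_comp, ← adjoint_inner_left (defectOp T) (defectOp T h) h, hs]
      _ = ⟪h, h⟫_ℂ - ⟪T h, T h⟫_ℂ := by
          rw [defectOp_mul_self T hT, ← adjoint_inner_right T, ← inner_sub_right]
          rfl
  simp only [inner_self_eq_norm_sq_to_K] at h1
  have h2 : ‖defectVec T h‖ = ‖defectOp T h‖ := rfl
  rw [h2]
  exact_mod_cast h1

/-- A vector `y` of the defect space vanishes if `h ↦ ⟪D h, y⟫` is, up to a unimodular factor,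
invariant under a strongly stable operator. -/
theorem eq_zero_of_inner_defectVec_eq {T C : H →L[ℂ] H}
    (hC : ∀ h, Tendsto (fun m : ℕ => ‖(C ^ m) h‖) atTop (𝓝 0)) {y : defectSpace T} {c : ℂ}
    (hc : ‖c‖ = 1) (hy : ∀ h, ⟪defectVec T h, y⟫_ℂ = c * ⟪defectVec T (C h), y⟫_ℂ) : y = 0 := by
  have hit : ∀ (m : ℕ) (h : H), ‖⟪defectVec T h, y⟫_ℂ‖ = ‖⟪defectVec T ((C ^ m) h), y⟫_ℂ‖ := by
    intro m
    induction m with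
    | zero => intro h; rfl
    | succ m ih =>
      intro h
      rw [ih h, hy, norm_mul, hc, one_mul, pow_succ', mul_apply_eq_comp]
  have h0 : ∀ h : H, ⟪defectOp T h, (y : H)⟫_ℂ = 0 := by
    intro h
    refine norm_eq_zero.1 (le_antisymm ?_ (norm_nonneg _))
    have hlim : Tendsto (fun m : ℕ => ‖defectOp T‖ * ‖(C ^ m) h‖ * ‖y‖) atTop (𝓝 0) := by
      simpa using ((hC h).const_mul ‖defectOp T‖).mul_const ‖y‖
    refine ge_of_tendsto' hlim fun m => ?_
    refine (hit m h).le.trans ((norm_inner_le_norm _ _).trans ?_)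
    exact mul_le_mul_of_nonneg_right ((defectOp T).le_opNorm _) (norm_nonneg _)
  -- As `y` lies in the closure of the range, being orthogonal to the range makes it orthogonal to
  -- itself.
  have hperp : (y : H) ∈ ((defectOp T).range.topologicalClosure)ᗮ := by
    rw [Submodule.orthogonal_closure, Submodule.mem_orthogonal]
    rintro _ ⟨h, rfl⟩
    exact h0 h
  exact Subtype.ext (inner_self_eq_zero.1 (Submodule.inner_right_of_mem_orthogonal y.2 hperp))

end Defect

/-! ### Isometric embeddings into sequence spaces -/

section Embedding

variable {H E : Type*} [NormedAddCommGroup H] [InnerProductSpace ℂ H]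
  [NormedAddCommGroup E] [InnerProductSpace ℂ E]

/-- If `‖W h‖² = ‖h‖² - ‖C h‖²` and `C` is strongly stable, then `h ↦ (W C^k h)_k` is an isometry
into the square-summable sequences. -/
theorem exists_isometry_orbit (C : H →L[ℂ] H) (W : H →ₗ[ℂ] E)
    (hW : ∀ h, ‖W h‖ ^ 2 = ‖h‖ ^ 2 - ‖C h‖ ^ 2)
    (hC : ∀ h, Tendsto (fun m : ℕ => ‖(C ^ m) h‖) atTop (𝓝 0)) :
    ∃ J : H →ₗᵢ[ℂ] lp (fun _ : ℕ => E) 2, ∀ h k, J h k = W ((C ^ k) h) := by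
  have hsum : ∀ h, HasSum (fun k : ℕ => ‖W ((C ^ k) h)‖ ^ 2) (‖h‖ ^ 2) := by
    intro h
    rw [hasSum_iff_tendsto_nat_of_nonneg fun _ => by positivity]
    -- The partial sums telescope.
    have hpart : ∀ n : ℕ, ∑ k ∈ Finset.range n, ‖W ((C ^ k) h)‖ ^ 2 =
        ‖h‖ ^ 2 - ‖(C ^ n) h‖ ^ 2 := by
      intro n
      induction n with
      | zero => simp
      | succ n ih =>
        rw [Finset.sum_range_succ, ih, hW, pow_succ' C, mul_apply_eq_comp]
        ring
    simp only [hpart]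
    simpa using ((hC h).pow 2).const_sub (‖h‖ ^ 2)
  refine ⟨⟨⟨⟨fun h => ⟨fun k => W ((C ^ k) h),
    (memlp_two_iff_summable _).2 (hsum h).summable⟩, ?_⟩, ?_⟩, ?_⟩, fun h k => rfl⟩
  · intro f g
    ext k
    change W ((C ^ k) (f + g)) = W ((C ^ k) f) + W ((C ^ k) g)
    rw [map_add, map_add]
  · intro c f
    ext k
    change W ((C ^ k) (c • f)) = c • W ((C ^ k) f)
    rw [map_smul, map_smul]
  · intro h
    rw [← sq_eq_sq₀ (norm_nonneg _) (norm_nonneg _), lp_two_norm_sq_eq_tsum]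
    exact (hsum h).tsum_eq

theorem pow_apply_comm {C S : H →L[ℂ] H} (h : Commute C S) (k : ℕ) (x : H) :
    (C ^ k) (S x) = S ((C ^ k) x) :=
  congrArg (fun Q : H →L[ℂ] H => Q x) (h.pow_left k).eq

/-- Comparing `k`-th coefficients and taking `g = C ^ k h` reduces the relation to the identity `hW`
in `E`. -/
theorem intertwining_lpPhi [CompleteSpace E] {C S : H →L[ℂ] H} (hCS : Commute C S) {W : H →ₗ[ℂ] E}
    {J : H →ₗᵢ[ℂ] lp (fun _ : ℕ => E) 2} (hJ : ∀ h k, J h k = W ((C ^ k) h)) (B : BCLTriple E)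
    (hW : ∀ g, B.U (B.P (W g) + (W (C g) - B.P (W (C g)))) = W (S g)) (h : H) :
    J (S h) = adjoint B.lpPhi (J h) := by
  refine lp.ext (funext fun k => ?_)
  rw [B.adjoint_lpPhi_apply, hJ, hJ, hJ, pow_apply_comm hCS, pow_succ' C, mul_apply_eq_comp, hW]

theorem intertwining_lpPsi [CompleteSpace E] {C S : H →L[ℂ] H} (hCS : Commute C S) {W : H →ₗ[ℂ] E}
    {J : H →ₗᵢ[ℂ] lp (fun _ : ℕ => E) 2} (hJ : ∀ h k, J h k = W ((C ^ k) h)) (B : BCLTriple E)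
    (hW : ∀ g, adjoint B.U (W g) - B.P (adjoint B.U (W g)) + B.P (adjoint B.U (W (C g))) = W (S g))
    (h : H) : J (S h) = adjoint B.lpPsi (J h) := by
  refine lp.ext (funext fun k => ?_)
  rw [B.adjoint_lpPsi_apply, hJ, hJ, hJ, pow_apply_comm hCS, pow_succ' C, mul_apply_eq_comp, hW]

theorem isPairDilation_hardyConj [CompleteSpace H] [CompleteSpace E] {T₁ T₂ : H →L[ℂ] H}
    {X Y : lp (fun _ : ℕ => E) 2 →L[ℂ] lp (fun _ : ℕ => E) 2}
    (J : H →ₗᵢ[ℂ] lp (fun _ : ℕ => E) 2) (h₁ : ∀ h, J (adjoint T₁ h) = adjoint X (J h))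
    (h₂ : ∀ h, J (adjoint T₂ h) = adjoint Y (J h)) :
    IsPairDilation T₁ T₂ (hardyConj X) (hardyConj Y) := by
  refine ⟨(HardySpace.coeffIsometry E).symm.toLinearIsometry.comp J, fun h => ⟨?_, ?_⟩⟩
  · rw [adjoint_hardyConj, hardyConj_apply]
    simp [h₁]
  · rw [adjoint_hardyConj, hardyConj_apply]
    simp [h₂]

/-- Two linear maps into a finite-dimensional space with the same pointwise norms differ by a
unitary. -/
theorem exists_unitary_of_norm_eq [CompleteSpace E] [FiniteDimensional ℂ E] (V W : H →ₗ[ℂ] E)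
    (hVW : ∀ h, ‖V h‖ = ‖W h‖) :
    ∃ U ∈ unitary (E →L[ℂ] E), ∀ h, U (V h) = W h := by
  -- For a linear section `g` of `V`, `W ∘ g` is isometric on the range of `V`. The choice of
  -- section is harmless because `V` and `W` have the same kernel.
  obtain ⟨g, hg⟩ := V.rangeRestrict.exists_rightInverse_of_surjective V.range_rangeRestrict
  have hVg : ∀ x : LinearMap.range V, V (g x) = x := fun x =>
    congrArg Subtype.val (LinearMap.congr_fun hg x)
  let L : LinearMap.range V →ₗᵢ[ℂ] E :=
    ⟨W ∘ₗ g, fun x => by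
      rw [LinearMap.comp_apply, ← hVW, hVg]
      rfl⟩
  let e : E ≃ₗᵢ[ℂ] E := L.extend.toLinearIsometryEquiv rfl
  refine ⟨Unitary.linearIsometryEquiv.symm e, (Unitary.linearIsometryEquiv.symm e).2, fun h => ?_⟩
  change L.extend (V h) = W h
  have h1 := L.extend_apply ⟨V h, LinearMap.mem_range_self V h⟩
  refine h1.trans ?_
  change W (g _) = W h
  rw [← sub_eq_zero, ← map_sub, ← norm_eq_zero, ← hVW, map_sub, hVg, sub_self, norm_zero]

end Embedding

/-! ### The projection onto the second summand -/

section Projection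

variable (X Y : Type*) [NormedAddCommGroup X] [InnerProductSpace ℂ X]
  [NormedAddCommGroup Y] [InnerProductSpace ℂ Y]

/-- The projection of a Hilbert space direct sum onto its second summand. -/
def sndProjection : WithLp 2 (X × Y) →L[ℂ] WithLp 2 (X × Y) :=
  (WithLp.prodContinuousLinearEquiv 2 ℂ X Y).symm.toContinuousLinearMap ∘L
    ContinuousLinearMap.inr ℂ X Y ∘L WithLp.sndL 2 ℂ X Y

variable {X Y}

theorem sndProjection_apply (x : WithLp 2 (X × Y)) :
    sndProjection X Y x = WithLp.toLp 2 (0, x.snd) := rfl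

theorem isStarProjection_sndProjection [CompleteSpace X] [CompleteSpace Y] :
    IsStarProjection (sndProjection X Y) := by
  refine ⟨rfl, ?_⟩
  rw [isSelfAdjoint_iff', eq_comm, eq_adjoint_iff]
  intro x y
  simp [sndProjection_apply, WithLp.prod_inner_apply]

end Projection

/-! ### The BCL triple of a pair of commuting pure contractions -/

section Pair

variable {H : Type*} [NormedAddCommGroup H] [InnerProductSpace ℂ H] [CompleteSpace H]
variable {T₁ T₂ : H →L[ℂ] H}

variable (T₁ T₂) in
/-- The map `h ↦ (D_{T₁^*} T₂^* h, D_{T₂^*} h)`. -/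
def defectPairLeft : H →ₗ[ℂ] DefectSum T₁ T₂ :=
  (WithLp.linearEquiv 2 ℂ _).symm.toLinearMap ∘ₗ
    ((defectVecLinear (adjoint T₁) ∘ₗ (adjoint T₂ : H →ₗ[ℂ] H)).prod (defectVecLinear (adjoint T₂)))

variable (T₁ T₂) in
/-- The map `h ↦ (D_{T₁^*} h, D_{T₂^*} T₁^* h)`. -/
def defectPairRight : H →ₗ[ℂ] DefectSum T₁ T₂ :=
  (WithLp.linearEquiv 2 ℂ _).symm.toLinearMap ∘ₗ
    ((defectVecLinear (adjoint T₁)).prod (defectVecLinear (adjoint T₂) ∘ₗ (adjoint T₁ : H →ₗ[ℂ] H)))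

theorem defectPairLeft_apply (h : H) : defectPairLeft T₁ T₂ h =
    WithLp.toLp 2 (defectVec (adjoint T₁) (adjoint T₂ h), defectVec (adjoint T₂) h) := rfl

theorem defectPairRight_apply (h : H) : defectPairRight T₁ T₂ h =
    WithLp.toLp 2 (defectVec (adjoint T₁) h, defectVec (adjoint T₂) (adjoint T₁ h)) := rfl

theorem norm_adjoint_le_one {T : H →L[ℂ] H} (hT : ‖T‖ ≤ 1) : ‖adjoint T‖ ≤ 1 := by
  rwa [LinearIsometryEquiv.norm_map]

theorem adjoint_apply_comm (hcomm : Commute T₁ T₂) (h : H) :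
    adjoint T₁ (adjoint T₂ h) = adjoint T₂ (adjoint T₁ h) := by
  have : Commute (adjoint T₁) (adjoint T₂) := hcomm.star_star
  exact congrArg (fun R : H →L[ℂ] H => R h) this.eq

theorem norm_defectPairLeft_sq (h₁ : ‖T₁‖ ≤ 1) (h₂ : ‖T₂‖ ≤ 1) (h : H) :
    ‖defectPairLeft T₁ T₂ h‖ ^ 2 = ‖h‖ ^ 2 - ‖adjoint T₁ (adjoint T₂ h)‖ ^ 2 := by
  have heq : ‖defectPairLeft T₁ T₂ h‖ ^ 2 =
      ‖defectVec (adjoint T₁) (adjoint T₂ h)‖ ^ 2 + ‖defectVec (adjoint T₂) h‖ ^ 2 :=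
    WithLp.prod_norm_sq_eq_of_L2 _
  rw [heq, norm_defectVec_sq _ (norm_adjoint_le_one h₁), norm_defectVec_sq _ (norm_adjoint_le_one h₂)]
  ring

theorem norm_defectPairRight_sq (h₁ : ‖T₁‖ ≤ 1) (h₂ : ‖T₂‖ ≤ 1) (h : H) :
    ‖defectPairRight T₁ T₂ h‖ ^ 2 = ‖h‖ ^ 2 - ‖adjoint T₂ (adjoint T₁ h)‖ ^ 2 := by
  have heq : ‖defectPairRight T₁ T₂ h‖ ^ 2 =
      ‖defectVec (adjoint T₁) h‖ ^ 2 + ‖defectVec (adjoint T₂) (adjoint T₁ h)‖ ^ 2 :=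
    WithLp.prod_norm_sq_eq_of_L2 _
  rw [heq, norm_defectVec_sq _ (norm_adjoint_le_one h₁), norm_defectVec_sq _ (norm_adjoint_le_one h₂)]
  ring

theorem exists_isCompleteFor (hcomm : Commute T₁ T₂) (h₁ : ‖T₁‖ ≤ 1) (h₂ : ‖T₂‖ ≤ 1)
    [FiniteDimensional ℂ (DefectSum T₁ T₂)] :
    ∃ B : BCLTriple (DefectSum T₁ T₂), B.IsCompleteFor := by
  obtain ⟨U, hU, hUV⟩ := exists_unitary_of_norm_eq (defectPairLeft T₁ T₂) (defectPairRight T₁ T₂)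
    fun h => by
      rw [← sq_eq_sq₀ (norm_nonneg _) (norm_nonneg _), norm_defectPairLeft_sq h₁ h₂,
        norm_defectPairRight_sq h₁ h₂, adjoint_apply_comm hcomm]
  exact ⟨⟨U, sndProjection _ _, hU, isStarProjection_sndProjection⟩, fun x y => rfl, hUV⟩

variable {B : BCLTriple (DefectSum T₁ T₂)}

theorem BCLTriple.IsCompleteFor.apply_P (hB : B.IsCompleteFor) (x : DefectSum T₁ T₂) :
    B.P x = WithLp.toLp 2 (0, x.snd) := hB.1 x.fst x.snd

theorem BCLTriple.IsCompleteFor.apply_U (hB : B.IsCompleteFor) (h : H) :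
    B.U (defectPairLeft T₁ T₂ h) = defectPairRight T₁ T₂ h := hB.2 h

theorem BCLTriple.IsCompleteFor.adjoint_U_apply (hB : B.IsCompleteFor) (h : H) :
    adjoint B.U (defectPairRight T₁ T₂ h) = defectPairLeft T₁ T₂ h :=
  (congrArg (adjoint B.U) (hB.apply_U h)).symm.trans (B.adjoint_U_apply_U _)

/-- The inner products of the vectors `U (D_{T₁^*} T₂^* h, D_{T₂^*} h)` with an eigenvector
of `U`. -/
theorem BCLTriple.IsCompleteFor.inner_eigenvector (hB : B.IsCompleteFor) {c : ℂ}
    {x : DefectSum T₁ T₂} (hx : B.U x = c • x) (h : H) :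
    ⟪defectPairLeft T₁ T₂ h, x⟫_ℂ = c * ⟪defectPairRight T₁ T₂ h, x⟫_ℂ := by
  rw [← inner_smul_right, ← hx, ← hB.apply_U, ← adjoint_inner_left, B.adjoint_U_apply_U]

/-- An eigenvector of `U` in the range of `P` is `(0, y)`, and pairing gives `⟪D_{T₂^*} h, y⟫ = c
⟪D_{T₂^*} T₁^* h, y⟫`; purity of `T₁` forces `y = 0`. -/
theorem BCLTriple.IsCompleteFor.isPureIsometry_phi (hB : B.IsCompleteFor)
    [FiniteDimensional ℂ (DefectSum T₁ T₂)] (hT₁ : IsPureContraction T₁) :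
    IsPureIsometry (hardyConj B.lpPhi) := by
  refine (B.isPureIsometry_lpPhi (tendsto_norm_pow_mul_projection B.unitary_U B.projection_P
    fun c x hc hPx hx => ?_)).hardyConj
  rw [hB.apply_P] at hPx
  have hx₂ : x.snd = 0 := by
    refine eq_zero_of_inner_defectVec_eq hT₁.2 hc fun h => ?_
    have := hB.inner_eigenvector hx h
    rw [← hPx] at this
    simpa [WithLp.prod_inner_apply, defectPairLeft_apply, defectPairRight_apply] using this
  rw [← hPx, hx₂]
  rfl

theorem BCLTriple.IsCompleteFor.isPureIsometry_psi (hB : B.IsCompleteFor)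
    [FiniteDimensional ℂ (DefectSum T₁ T₂)] (hT₂ : IsPureContraction T₂) :
    IsPureIsometry (hardyConj B.lpPsi) := by
  refine (B.isPureIsometry_lpPsi (tendsto_norm_pow_mul_projection B.unitary_U
    B.projection_P.one_sub fun c x hc hPx hx => ?_)).hardyConj
  have hPx' : B.P x = 0 := by simpa using hPx
  rw [hB.apply_P] at hPx'
  have hsnd : x.snd = 0 := congrArg WithLp.snd hPx'
  have hx₁ : x.fst = 0 := by
    have hc0 : c ≠ 0 := norm_ne_zero_iff.1 (by rw [hc]; exact one_ne_zero)
    -- For `x = (y, 0)` the pairing reads `⟪D_{T₁^*} T₂^* h, y⟫ = c ⟪D_{T₁^*} h, y⟫`, with the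
    -- iterated operator on the other side, hence the inverse.
    refine eq_zero_of_inner_defectVec_eq hT₂.2 (c := c⁻¹) (by rw [norm_inv, hc, inv_one])
      fun h => ?_
    have := hB.inner_eigenvector hx h
    rw [eq_inv_mul_iff_mul_eq₀ hc0]
    simpa [WithLp.prod_inner_apply, defectPairLeft_apply, defectPairRight_apply, hsnd]
      using this.symm
  have : x = WithLp.toLp 2 (x.fst, x.snd) := rfl
  rw [this, hx₁, hsnd]
  rfl

theorem tendsto_pow_adjoint_mul (hcomm : Commute T₁ T₂) (hT₁ : IsPureContraction T₁)
    (hT₂ : IsPureContraction T₂) (h : H) :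
    Tendsto (fun m : ℕ => ‖((adjoint T₁ * adjoint T₂) ^ m) h‖) atTop (𝓝 0) := by
  have hc : Commute (adjoint T₁) (adjoint T₂) := hcomm.star_star
  refine squeeze_zero (fun _ => norm_nonneg _) (fun m => ?_) (hT₂.2 h)
  rw [hc.mul_pow, mul_apply_eq_comp]
  exact norm_pow_apply_le (norm_adjoint_le_one hT₁.1) m _

/-- The second component of `W g` and the first of `W (T₁^* T₂^* g)` form `V (T₁^* g)`, which `U`
carries to `W (T₁^* g)`. -/
theorem BCLTriple.IsCompleteFor.phi_intertwining (hB : B.IsCompleteFor) (hcomm : Commute T₁ T₂)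
    (g : H) :
    B.U (B.P (defectPairRight T₁ T₂ g) +
      (defectPairRight T₁ T₂ (adjoint T₁ (adjoint T₂ g)) -
        B.P (defectPairRight T₁ T₂ (adjoint T₁ (adjoint T₂ g))))) =
    defectPairRight T₁ T₂ (adjoint T₁ g) := by
  rw [← hB.apply_U (adjoint T₁ g)]
  congr 1
  rw [hB.apply_P, hB.apply_P, defectPairLeft_apply, defectPairRight_apply, defectPairRight_apply,
    adjoint_apply_comm hcomm g]
  refine WithLp.ofLp_injective 2 (Prod.ext ?_ ?_) <;> simp

/-- `U^*` turns `W` into `V`; the first component of `V g` and the second of `V (T₁^* T₂^* g)` form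
`W (T₂^* g)`. -/
theorem BCLTriple.IsCompleteFor.psi_intertwining (hB : B.IsCompleteFor) (g : H) :
    adjoint B.U (defectPairRight T₁ T₂ g) - B.P (adjoint B.U (defectPairRight T₁ T₂ g)) +
      B.P (adjoint B.U (defectPairRight T₁ T₂ (adjoint T₁ (adjoint T₂ g)))) =
    defectPairRight T₁ T₂ (adjoint T₂ g) := by
  rw [hB.adjoint_U_apply, hB.adjoint_U_apply, hB.apply_P, hB.apply_P, defectPairLeft_apply,
    defectPairLeft_apply, defectPairRight_apply]
  refine WithLp.ofLp_injective 2 (Prod.ext ?_ ?_) <;> simp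

theorem BCLTriple.IsCompleteFor.isPairDilation (hB : B.IsCompleteFor) (hcomm : Commute T₁ T₂)
    (hT₁ : IsPureContraction T₁) (hT₂ : IsPureContraction T₂) :
    IsPairDilation T₁ T₂ (hardyConj B.lpPhi) (hardyConj B.lpPsi) := by
  have hc : Commute (adjoint T₁) (adjoint T₂) := hcomm.star_star
  obtain ⟨J, hJ⟩ := exists_isometry_orbit (adjoint T₁ * adjoint T₂) (defectPairRight T₁ T₂)
    (fun h => by
      rw [norm_defectPairRight_sq hT₁.1 hT₂.1, mul_apply_eq_comp, adjoint_apply_comm hcomm])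
    (tendsto_pow_adjoint_mul hcomm hT₁ hT₂)
  have hphi := intertwining_lpPhi ((Commute.refl _).mul_left hc.symm) hJ B
    (hB.phi_intertwining hcomm)
  have hpsi := intertwining_lpPsi (hc.mul_left (Commute.refl _)) hJ B hB.psi_intertwining
  exact isPairDilation_hardyConj J hphi hpsi

end Pair

end PureDilation

end

theorem theorem5p2 {H : Type*} [NormedAddCommGroup H] [InnerProductSpace ℂ H] [CompleteSpace H]
    (T₁ T₂ : H →L[ℂ] H) (hcomm : Commute T₁ T₂)
    (hT₁ : PureDilation.IsPureContraction T₁) (hT₂ : PureDilation.IsPureContraction T₂)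
    (hfin₁ : FiniteDimensional ℂ (PureDilation.defectSpace (adjoint T₁)))
    (hfin₂ : FiniteDimensional ℂ (PureDilation.defectSpace (adjoint T₂))) :
    ∃ (B : PureDilation.BCLTriple (PureDilation.DefectSum T₁ T₂))
      (MΦ MΨ : PureDilation.HardySpace (PureDilation.DefectSum T₁ T₂) →L[ℂ]
        PureDilation.HardySpace (PureDilation.DefectSum T₁ T₂)),
      B.IsCompleteFor ∧
      PureDilation.IsMulOperator B.symbolPhi MΦ ∧
      PureDilation.IsMulOperator B.symbolPsi MΨ ∧
      Commute MΦ MΨ ∧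
      PureDilation.IsPureIsometry MΦ ∧
      PureDilation.IsPureIsometry MΨ ∧
      PureDilation.IsPairDilation T₁ T₂ MΦ MΨ := by
  have : FiniteDimensional ℂ (PureDilation.DefectSum T₁ T₂) :=
    Module.Finite.equiv (WithLp.linearEquiv 2 ℂ _).symm
  obtain ⟨B, hB⟩ := PureDilation.exists_isCompleteFor hcomm hT₁.1 hT₂.1
  exact ⟨B, PureDilation.hardyConj B.lpPhi, PureDilation.hardyConj B.lpPsi, hB,
    B.isMulOperator_lpPhi, B.isMulOperator_lpPsi, PureDilation.Commute.hardyConj B.commute_lp,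
    hB.isPureIsometry_phi hT₁, hB.isPureIsometry_psi hT₂, hB.isPairDilation hcomm hT₁ hT₂⟩
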